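/- Let $G$ be a finite group and let $H\le G$ be a nonnormal T.I. subgroup, i.e. $H$ is not normal in $G$ and for every $x\in G$ the intersection $H\cap H^x$ is either $H$ or trivial. Let $\pi$ be the set of primes dividing $|H|$, and assume that $G$ is $\pi$-separable, i.e. $G$ has a series $1=G_0\le G_1\le\dots\le G_n=G$ of normal subgroups of $G$ such that each factor $G_{i+1}/G_i$ is a $\pi$-group or a $\pi'$-group. Assume that $H$ is a Hall subgroup of its normalizer $N_G(H)$, i.e. $\gcd(|H|,|N_G(H):H|)=1$. Assume further that a Sylow $2$-subgroup of $H$ is abelian, and let $Q$ be a complement of $H$ in $N_G(H)$, i.e. $Q\le N_G(H)$, $HQ=N_G(H)$ and $H\cap Q=1$. Then $C_H(Q)$, the centralizer of $Q$ in $H$, is a Hall subgroup of $G$ (its order is coprime to its index in $G$) and it has a normal complement in $G$: there is a normal subgroup $N$ of $G$ with $N\,C_H(Q)=G$ and $N\cap C_H(Q)=1$. -/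

import Mathlib

/-- `H` is a T.I. subgroup of `G`: for every `x`, the intersection of `H` with its conjugate
`x H x⁻¹` is `H` or trivial. -/
def Subgroup.IsTI {G : Type*} [Group G] (H : Subgroup G) : Prop :=
  ∀ x : G, H ⊓ H.map (MulAut.conj x).toMonoidHom = H ∨
    H ⊓ H.map (MulAut.conj x).toMonoidHom = ⊥

/-- `H` is a Hall subgroup of the finite group `G`: its order is coprime to its index. -/
def Subgroup.IsHall {G : Type*} [Group G] (H : Subgroup G) : Prop :=
  (Nat.card H).Coprime H.index

/-- `n` is a `π`-number: each of its prime divisors lies in `π`. -/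
def IsPiNumber (π : Set ℕ) (n : ℕ) : Prop :=
  ∀ p : ℕ, p.Prime → p ∣ n → p ∈ π

/-- The finite group `G` is `π`-separable: it has a series
`1 = s 0 ≤ s 1 ≤ ⋯ ≤ s n = G` of normal subgroups of `G` such that each factor
`s (i + 1) / s i` is a `π`-group or a `π'`-group. The order of that factor is
`(s i).relIndex (s (i + 1))`, and `π'` is the set of primes outside `π`. -/
def IsPiSeparable (π : Set ℕ) (G : Type*) [Group G] : Prop :=
  ∃ (n : ℕ) (s : ℕ → Subgroup G), s 0 = ⊥ ∧ s n = ⊤ ∧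
    (∀ i ≤ n, (s i).Normal) ∧
    ∀ i < n, s i ≤ s (i + 1) ∧
      (IsPiNumber π ((s i).relIndex (s (i + 1))) ∨
        IsPiNumber πᶜ ((s i).relIndex (s (i + 1))))

/-!
Let `H` be T.I. If `1 ≠ P ≤ H` then `N(P) ≤ N(H)`, so a Sylow subgroup of `H` is one of `G`, and
`H` is a Hall subgroup of `G`. A Frattini argument on the `π`-series gives `G = N(H) M` with `M`
normal of order coprime to `|H|`. An element of `M` commuting with some `1 ≠ h ∈ H` normalizes,
hence centralizes `H`.

If a Sylow `p`-subgroup of `H` contained an elementary abelian subgroup `A` of order `p²`, then by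
coprime action `M` would be generated by the centralizers in `M` of the nontrivial elements of `A`;
so `M` would centralize `H`, and `H` would be normal in `N(H) M = G`. As abelian Sylow
`2`-subgroups exclude quaternion groups, all Sylow subgroups of `H` are cyclic, and `H'` and `H/H'`
are cyclic of coprime orders.

In `G/M` the image of `H` is normal, with complement the image of `Q`. If a prime `p` divides
`|C_H(Q)|`, the Sylow `p`-subgroup of one of `H'` and `H/H'` is a cyclic group on which `Q` fixes a
nontrivial element, so by coprime action `Q` centralizes it, and Burnside's transfer shows that
`p` does not divide the order of the normal closure of `Q`. The preimage in `G` of this normal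
closure is the complement; `H = C_H(Q) [H, Q]` shows that it generates `G` with `C_H(Q)`.
-/

open Subgroup
open scoped commutatorElement

theorem mul_pow_of_mul_eq_mul_mul {P : Type*} [Group P] {x y c : P} (h : y * x = c * x * y)
    (hcx : Commute c x) (hcy : Commute c y) (n : ℕ) :
    (x * y) ^ n = c ^ n.choose 2 * x ^ n * y ^ n := by
  have hcyx : SemiconjBy y x (c * x) := h
  have hcxn (n : ℕ) : SemiconjBy (y ^ n) x (c ^ n * x) := by
    induction n with
    | zero => simp
    | succ n ih =>
      have hyc : SemiconjBy y (c ^ n * x) (c ^ n * (c * x)) :=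
        (hcy.symm.pow_right n).semiconjBy.mul_right hcyx
      rw [pow_succ', pow_succ, mul_assoc (c ^ n)]
      exact hyc.mul_left ih
  induction n with
  | zero => simp
  | succ n ih =>
    have hchoose : (n + 1).choose 2 = n.choose 2 + n := by
      rw [Nat.choose_succ_succ' n 1, Nat.choose_one_right, add_comm]
    calc (x * y) ^ (n + 1) = c ^ n.choose 2 * x ^ n * (y ^ n * x) * y := by
          rw [pow_succ, ih]; simp only [mul_assoc]
      _ = c ^ n.choose 2 * (x ^ n * c ^ n) * x * y ^ n * y := by
          rw [(hcxn n).eq]; simp only [mul_assoc]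
      _ = c ^ (n + 1).choose 2 * x ^ (n + 1) * y ^ (n + 1) := by
          rw [(hcx.pow_pow n n).eq.symm, hchoose, pow_add, pow_succ x, pow_succ y]
          simp only [mul_assoc]

theorem mul_pow_prime_of_commutator_le_center {p : ℕ} [hp : Fact p.Prime] {P : Type*} [Group P]
    (hp2 : p ≠ 2) (hcomm : commutator P ≤ center P) (hpow : ∀ x : P, x ^ p ∈ center P) (x y : P) :
    (x * y) ^ p = x ^ p * y ^ p := by
  have hc : ⁅y, x⁆ ∈ center P := hcomm (commutator_mem_commutator (mem_top y) (mem_top x))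
  have hcz (z : P) : Commute ⁅y, x⁆ z := (mem_center_iff.1 hc z).symm
  have hyx : y * x = ⁅y, x⁆ * x * y := by simp [commutatorElement_def]
  have hone : ⁅y, x⁆ ^ p = 1 := by
    have hconj : (⁅y, x⁆ * x) ^ p = x ^ p := by
      rw [show ⁅y, x⁆ * x = y * x * y⁻¹ by simp [commutatorElement_def], conj_pow,
        mem_center_iff.1 (hpow x) y, mul_inv_cancel_right]
    rwa [(hcz x).mul_pow, mul_eq_right] at hconj
  obtain ⟨k, hk⟩ := hp.out.dvd_choose_self two_ne_zero (lt_of_le_of_ne' hp.out.two_le hp2)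
  rw [mul_pow_of_mul_eq_mul_mul hyx (hcz x) (hcz y), hk, pow_mul, hone, one_pow, one_mul]

section MaximalSubgroups

variable {p : ℕ} [hp : Fact p.Prime] {P : Type*} [Group P] [Finite P]

theorem normal_of_isCoatom_of_isPGroup (hP : IsPGroup p P) {M : Subgroup P} (hM : IsCoatom M) :
    M.Normal := by
  have hnil : Group.IsNilpotent P ↔ ∀ H : Subgroup P, IsCoatom H → H.Normal :=
    (Group.isNilpotent_of_finite_tfae (G := P)).out 0 2
  exact hnil.1 hP.isNilpotent M hM

theorem index_of_isCoatom_of_isPGroup (hP : IsPGroup p P) {M : Subgroup P} (hM : IsCoatom M) :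
    M.index = p := by
  obtain ⟨n, hn⟩ := IsPGroup.iff_card.1 (hP.to_subgroup M)
  have hdvd : p ∣ M.index := (hP.index M).elim fun k hk => by
    rw [hk]
    refine dvd_pow_self p ?_
    rintro rfl
    exact hM.1 (index_eq_one.1 hk)
  have hcard : p ^ (n + 1) ∣ Nat.card P := by
    rw [← M.card_mul_index, hn, pow_succ]
    exact mul_dvd_mul_left _ hdvd
  obtain ⟨K, hK, hMK⟩ := Sylow.exists_subgroup_card_pow_succ hcard hn
  have hKtop : K = ⊤ := by
    refine hM.2 K (hMK.lt_of_ne ?_)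
    rintro rfl
    exact (Nat.pow_lt_pow_succ hp.out.one_lt).ne (hn.symm.trans hK)
  refine Nat.eq_of_mul_eq_mul_left (pow_pos hp.out.pos n) ?_
  rw [← hn, M.card_mul_index, ← card_top, ← hKtop, hK, hn, pow_succ]

theorem pow_mem_of_isCoatom_of_isPGroup (hP : IsPGroup p P) {M : Subgroup P} (hM : IsCoatom M)
    (x : P) : x ^ p ∈ M := by
  have := normal_of_isCoatom_of_isPGroup hP hM
  exact index_of_isCoatom_of_isPGroup hP hM ▸ M.pow_index_mem x

theorem commutator_le_of_isCoatom_of_isPGroup (hP : IsPGroup p P) {M : Subgroup P}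
    (hM : IsCoatom M) : commutator P ≤ M := by
  have := normal_of_isCoatom_of_isPGroup hP hM
  have : IsCyclic (P ⧸ M) := isCyclic_of_prime_card (index_of_isCoatom_of_isPGroup hP hM)
  exact Normal.quotient_commutative_iff_commutator_le.1 inferInstance

end MaximalSubgroups

theorem exists_isCoatom_ne_of_not_isCyclic {P : Type*} [Group P] [Finite P] (hP : ¬ IsCyclic P) :
    ∃ M₁ M₂ : Subgroup P, IsCoatom M₁ ∧ IsCoatom M₂ ∧ M₁ ≠ M₂ := by
  have hzpowers (x : P) : ∃ M : Subgroup P, IsCoatom M ∧ x ∈ M := by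
    obtain htop | ⟨M, hM, hx⟩ := eq_top_or_exists_le_coatom (zpowers x)
    · exact absurd ⟨x, fun y => mem_zpowers_iff.1 (htop ▸ mem_top y)⟩ hP
    · exact ⟨M, hM, hx (mem_zpowers x)⟩
  obtain ⟨M₁, hM₁, -⟩ := hzpowers 1
  obtain ⟨x, -, hx⟩ := SetLike.exists_of_lt hM₁.lt_top
  obtain ⟨M₂, hM₂, hx₂⟩ := hzpowers x
  exact ⟨M₁, M₂, hM₁, hM₂, fun h => hx (h ▸ hx₂)⟩

theorem inf_le_center_of_sup_eq_top {P : Type*} [Group P] {A B : Subgroup P}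
    (hA : IsMulCommutative A) (hB : IsMulCommutative B) (hsup : A ⊔ B = ⊤) :
    A ⊓ B ≤ center P := by
  rw [← centralizer_univ, ← coe_top, ← hsup, le_centralizer_iff]
  exact sup_le
    ((le_centralizer_iff_isMulCommutative.2 hA).trans (centralizer_le inf_le_left))
    ((le_centralizer_iff_isMulCommutative.2 hB).trans (centralizer_le inf_le_right))

theorem mul_pow_prime_of_isCoatom_of_ne {p : ℕ} [Fact p.Prime] {P : Type*} [Group P]
    [Finite P] (hP : IsPGroup p P) (hp2 : p ≠ 2) {M₁ M₂ : Subgroup P} (hM₁ : IsCoatom M₁)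
    (hM₂ : IsCoatom M₂) (hne : M₁ ≠ M₂) (hcomm₁ : IsMulCommutative M₁)
    (hcomm₂ : IsMulCommutative M₂) (x y : P) : (x * y) ^ p = x ^ p * y ^ p := by
  have hcenter : M₁ ⊓ M₂ ≤ center P :=
    inf_le_center_of_sup_eq_top hcomm₁ hcomm₂ (hM₁.sup_eq_top_of_ne hM₂ hne)
  have hcommutator : commutator P ≤ center P :=
    (le_inf (commutator_le_of_isCoatom_of_isPGroup hP hM₁)
      (commutator_le_of_isCoatom_of_isPGroup hP hM₂)).trans hcenter
  exact mul_pow_prime_of_commutator_le_center hp2 hcommutator (fun x => hcenter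
    ⟨pow_mem_of_isCoatom_of_isPGroup hP hM₁ x, pow_mem_of_isCoatom_of_isPGroup hP hM₂ x⟩) x y

theorem isCyclic_of_card_ker_pow_le {p : ℕ} [hp : Fact p.Prime] {P : Type*} [Group P] [Finite P]
    (hP : IsPGroup p P) (f : P →* P) (hf : ∀ x, f x = x ^ p) (hker : Nat.card f.ker ≤ p) :
    IsCyclic P := by
  by_contra hcyc
  obtain ⟨M₁, M₂, hM₁, hM₂, hne⟩ := exists_isCoatom_ne_of_not_isCyclic hcyc
  have hrange {M : Subgroup P} (hM : IsCoatom M) : f.range = M := by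
    refine eq_of_le_of_not_lt ?_ fun hlt => ?_
    · rintro _ ⟨x, rfl⟩
      exact hf x ▸ pow_mem_of_isCoatom_of_isPGroup hP hM x
    · have := index_strictAnti hlt
      rw [index_range, index_of_isCoatom_of_isPGroup hP hM] at this
      omega
  exact hne ((hrange hM₁).symm.trans (hrange hM₂))

theorem isCyclic_of_forall_mem_zpowers_of_isPGroup {p : ℕ} [hp : Fact p.Prime] {P : Type*}
    [Group P] [Finite P] (hP : IsPGroup p P) (hp2 : p = 2 → IsMulCommutative P)
    (h : ∀ a b : P, orderOf a = p → orderOf b = p → Commute a b → a ∈ zpowers b) :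
    IsCyclic P := by
  induction hn : Nat.card P using Nat.strong_induction_on generalizing P with
  | _ n ih =>
  subst hn
  by_contra hcyc
  have hsub {M : Subgroup P} (hM : IsCoatom M) : IsMulCommutative M := by
    have : IsCyclic M := by
      refine ih _ (M.card_le_card_group.lt_of_ne fun h => hM.1 (eq_top_of_card_eq M h))
        (hP.to_subgroup M) (fun h2 => ?_) (fun a b ha hb hab => ?_) rfl
      · have := hp2 h2
        infer_instance
      · obtain ⟨k, hk⟩ := h a b (by rwa [orderOf_coe]) (by rwa [orderOf_coe]) (hab.map M.subtype)
        exact ⟨k, Subtype.ext hk⟩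
    infer_instance
  obtain ⟨M₁, M₂, hM₁, hM₂, hne⟩ := exists_isCoatom_ne_of_not_isCyclic hcyc
  have hmul (x y : P) : (x * y) ^ p = x ^ p * y ^ p := by
    by_cases h2 : p = 2
    · have := hp2 h2
      exact Commute.mul_pow (mul_comm' x y) p
    · exact mul_pow_prime_of_isCoatom_of_ne hP h2 hM₁ hM₂ hne (hsub hM₁) (hsub hM₂) x y
  let f : P →* P := { toFun := (· ^ p), map_one' := one_pow p, map_mul' := hmul }
  have : Nontrivial P := not_subsingleton_iff_nontrivial.1 fun _ => hcyc inferInstance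
  have := hP.center_nontrivial
  obtain ⟨b, hb⟩ := exists_prime_orderOf_dvd_card' (G := center P) p
    ((hP.to_subgroup _).card_eq_or_dvd.resolve_left Finite.one_lt_card.ne')
  rw [← orderOf_coe] at hb
  have hker : f.ker ≤ zpowers (b : P) := fun a ha => by
    by_cases ha1 : a = 1
    · exact ha1 ▸ one_mem _
    · exact h a b (orderOf_eq_prime ha ha1) hb (mem_center_iff.1 b.2 a)
  refine hcyc (isCyclic_of_card_ker_pow_le hP f (fun _ => rfl) ?_)
  exact (card_le_of_le hker).trans_eq ((Nat.card_zpowers _).trans hb)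

section SolvableNormal

variable {G : Type*} [Group G]

theorem commutator_self_lt_of_isSolvable {K : Subgroup G} [Group.IsSolvable K] (hK : K ≠ ⊥) :
    ⁅K, K⁆ < K := by
  refine lt_of_le_of_ne (commutator_le_self K) fun h => ?_
  have := nontrivial_iff_ne_bot K |>.2 hK
  refine (Group.IsSolvable.commutator_lt_top_of_nontrivial K).ne
    (map_injective K.subtype_injective ?_)
  rw [map_subtype_commutator, h, ← MonoidHom.range_eq_map, range_subtype]

theorem isMulCommutative_map_mk'_commutator_self (K : Subgroup G) [K.Normal] :
    IsMulCommutative (K.map (QuotientGroup.mk' ⁅K, K⁆)) := by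
  rw [← le_centralizer_iff_isMulCommutative, ← commutator_eq_bot_iff_le_centralizer,
    ← map_commutator, Subgroup.map_eq_bot_iff, QuotientGroup.ker_mk']

theorem solvable_normal_induction [Finite G] {motive : Subgroup G → Prop} (bot : motive ⊥)
    (step : ∀ (K : Subgroup G) [K.Normal], Group.IsSolvable K → motive ⁅K, K⁆ → motive K)
    (K : Subgroup G) [hK : K.Normal] [hsol : Group.IsSolvable K] : motive K := by
  induction K using WellFoundedLT.induction generalizing hK hsol with
  | _ K ih =>
  by_cases hbot : K = ⊥
  · exact hbot ▸ bot
  have hlt := commutator_self_lt_of_isSolvable hbot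
  have : Group.IsSolvable ↥⁅K, K⁆ :=
    Group.isSolvable_of_isSolvable_injective (inclusion_injective hlt.le)
  exact step K hsol (ih _ hlt)

end SolvableNormal

section CoprimeAction

variable {N : Type*} [Group N] [Finite N] {K Q : Subgroup N} [K.Normal]

theorem exists_mul_commute_of_coprime_of_isMulCommutative [IsMulCommutative K]
    (hcop : (Nat.card K).Coprime (Nat.card Q)) {h : N}
    (hh : ∀ q ∈ Q, h⁻¹ * (q * h * q⁻¹) ∈ K) : ∃ k ∈ K, ∀ q ∈ Q, Commute q (h * k) := by
  have := Fintype.ofFinite Q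
  let _ : CommGroup K := { mul_comm := mul_comm' }
  let φ : N →* MulAut K := MulAut.conjNormal
  -- `f` is a cocycle; the product of its values exhibits its `|Q|`-th power as a coboundary.
  let f (q : Q) : K := ⟨h⁻¹ * (q * h * (q : N)⁻¹), hh q q.2⟩
  have hf (q r : Q) : f (q * r) = f q * φ q (f r) := by
    refine Subtype.ext ?_
    simp [f, φ, mul_assoc]
  let F : K := ∏ r, f r
  have hF (q : Q) : F = f q ^ Nat.card Q * φ q F := by
    calc F = ∏ r, f (q * r) := (Fintype.prod_equiv (Equiv.mulLeft q) _ _ fun r => rfl).symm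
      _ = f q ^ Nat.card Q * φ q F := by
        simp only [hf, Finset.prod_mul_distrib, Finset.prod_const, ← map_prod, Finset.card_univ,
          Nat.card_eq_fintype_card, F]
  obtain ⟨c, hc : c ^ Nat.card Q = F⟩ := (powCoprime hcop).surjective F
  refine ⟨c, c.2, fun q hq => ?_⟩
  have hcq : c = f ⟨q, hq⟩ * φ q c := by
    refine (powCoprime hcop).injective ?_
    rw [powCoprime_apply, powCoprime_apply, mul_pow, ← map_pow, hc]
    exact hF ⟨q, hq⟩
  have hcqN : (c : N) = h⁻¹ * (q * h * q⁻¹) * (q * c * q⁻¹) := congrArg Subtype.val hcq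
  rw [Commute, SemiconjBy, ← mul_inv_eq_iff_eq_mul]
  conv_rhs => rw [hcqN]
  simp [mul_assoc]

theorem exists_mul_commute_of_coprime [hK : Group.IsSolvable K]
    (hcop : (Nat.card K).Coprime (Nat.card Q)) {h : N}
    (hh : ∀ q ∈ Q, h⁻¹ * (q * h * q⁻¹) ∈ K) : ∃ k ∈ K, ∀ q ∈ Q, Commute q (h * k) := by
  induction K using solvable_normal_induction generalizing h with
  | bot =>
    refine ⟨1, one_mem _, fun q hq => ?_⟩
    have hq1 := mem_bot.1 (hh q hq)
    rw [inv_mul_eq_one, eq_mul_inv_iff_mul_eq] at hq1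
    rw [mul_one]
    exact hq1.symm
  | step K _ ih =>
    let π := QuotientGroup.mk' ⁅K, K⁆
    have := isMulCommutative_map_mk'_commutator_self K
    have : (K.map π).Normal := Normal.map inferInstance π (QuotientGroup.mk'_surjective _)
    obtain ⟨_, ⟨k, hk, rfl⟩, hkQ⟩ := exists_mul_commute_of_coprime_of_isMulCommutative
      (K := K.map π) (Q := Q.map π) (h := π h)
      ((hcop.coprime_dvd_left (card_map_dvd _ π)).coprime_dvd_right (card_map_dvd _ π)) (by
        rintro _ ⟨q, hq, rfl⟩
        exact ⟨_, hh q hq, by simp⟩)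
    obtain ⟨k', hk', hcomm⟩ := ih (h := h * k)
      (hcop.coprime_dvd_left (card_dvd_of_le (commutator_le_self K))) fun q hq => by
        have hqk : π q * π (h * k) = π (h * k) * π q := by
          rw [map_mul π h]
          exact hkQ (π q) ⟨q, hq, rfl⟩
        rw [← QuotientGroup.ker_mk' ⁅K, K⁆, MonoidHom.mem_ker]
        change π _ = 1
        rw [map_mul, map_mul, map_mul, hqk, map_inv, map_inv, mul_inv_cancel_right, inv_mul_cancel]
    exact ⟨k * k', mul_mem hk (commutator_le_self K hk'), fun q hq => mul_assoc h k k' ▸ hcomm q hq⟩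

theorem exists_mul_commute_of_coprime_orderOf [Group.IsSolvable K] {g h : N}
    (hcop : (Nat.card K).Coprime (orderOf g))
    (hgh : Commute (QuotientGroup.mk' K g) (QuotientGroup.mk' K h)) :
    ∃ k ∈ K, Commute g (h * k) := by
  let π := QuotientGroup.mk' K
  have hle : zpowers g ≤ (centralizer {π h}).comap π := by
    rw [zpowers_le, mem_comap, mem_centralizer_singleton_iff]
    exact hgh.eq
  rw [← Nat.card_zpowers] at hcop
  obtain ⟨k, hk, hcomm⟩ := exists_mul_commute_of_coprime hcop (h := h) fun q hq => by
    rw [← QuotientGroup.eq_one_iff]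
    change (π h)⁻¹ * (π q * π h * (π q)⁻¹) = 1
    rw [mem_centralizer_singleton_iff.1 (hle hq), mul_inv_cancel_right, inv_mul_cancel]
  exact ⟨k, hk, hcomm g (mem_zpowers g)⟩

end CoprimeAction

theorem smul_prod_range_pow_smul {E V : Type*} [Group E] [CommGroup V] [MulDistribMulAction E V]
    {g : E} {n : ℕ} (hg : g ^ n = 1) (x : V) :
    g • ∏ j ∈ Finset.range n, g ^ j • x = ∏ j ∈ Finset.range n, g ^ j • x := by
  refine mul_right_cancel (b := g ^ 0 • x) ?_
  calc (g • ∏ j ∈ Finset.range n, g ^ j • x) * g ^ 0 • x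
      = ∏ j ∈ Finset.range (n + 1), g ^ j • x := by
        simp only [Finset.smul_prod', smul_smul, ← pow_succ']
        rw [← Finset.prod_range_succ' (fun j => g ^ j • x)]
    _ = (∏ j ∈ Finset.range n, g ^ j • x) * g ^ 0 • x := by
        rw [Finset.prod_range_succ, hg, pow_zero]

section RankTwo

variable {E : Type*} [Group E] {p : ℕ} [hp : Fact p.Prime] {a b : E}

theorem pow_mem_of_forall_smul_eq_mem {V : Type*} [CommGroup V] [MulDistribMulAction E V]
    (hab : Commute a b) (ha : orderOf a = p) (hb : orderOf b = p) (hnot : a ∉ zpowers b)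
    {F : Subgroup V} (hF : ∀ e : E, orderOf e = p → ∀ x : V, e • x = x → x ∈ F) (x : V) :
    x ^ p ∈ F := by
  have hpow (i : ℕ) : (a * b ^ i) ^ p = 1 := by
    rw [(hab.pow_right i).mul_pow, ← pow_mul, mul_comm, pow_mul, ← ha, pow_orderOf_eq_one, ha, ← hb,
      pow_orderOf_eq_one, one_pow, one_mul]
  have hne (i : ℕ) : a * b ^ i ≠ 1 := fun h =>
    hnot (eq_inv_of_mul_eq_one_left h ▸ inv_mem (npow_mem_zpowers b i))
  have hnorm {e : E} (he : e ^ p = 1) (he1 : e ≠ 1) (y : V) :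
      ∏ j ∈ Finset.range p, e ^ j • y ∈ F :=
    hF e (orderOf_eq_prime he he1) _ (smul_prod_range_pow_smul he y)
  -- The terms with `j = 0` contribute `x ^ p`; for `j ≠ 0` the inner product is a norm for `b ^ j`.
  have hswap : ∏ i ∈ Finset.range p, ∏ j ∈ Finset.range p, (a * b ^ i) ^ j • x =
      x ^ p * ∏ j ∈ (Finset.range p).erase 0,
        ∏ i ∈ Finset.range p, (b ^ j) ^ i • (a ^ j • x) := by
    rw [Finset.prod_comm, ← Finset.mul_prod_erase _ _ (Finset.mem_range.2 hp.out.pos)]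
    congr 1
    · simp
    · refine Finset.prod_congr rfl fun j _ => Finset.prod_congr rfl fun i _ => ?_
      rw [(hab.pow_right i).mul_pow, ← pow_mul, (hab.pow_pow j _).eq, smul_smul, ← pow_mul,
        mul_comm]
  have hleft : ∏ i ∈ Finset.range p, ∏ j ∈ Finset.range p, (a * b ^ i) ^ j • x ∈ F :=
    prod_mem fun i _ => hnorm (hpow i) (hne i) x
  have hright : ∏ j ∈ (Finset.range p).erase 0,
      ∏ i ∈ Finset.range p, (b ^ j) ^ i • (a ^ j • x) ∈ F :=
    prod_mem fun j hj => by
      obtain ⟨hj0, hjp⟩ := Finset.mem_erase.1 hj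
      refine hnorm ?_ (pow_ne_one_of_lt_orderOf hj0 (hb ▸ Finset.mem_range.1 hjp)) _
      rw [← pow_mul, mul_comm, pow_mul, ← hb, pow_orderOf_eq_one, one_pow]
  rw [hswap] at hleft
  exact (F.mul_mem_cancel_right hright).1 hleft

variable {G : Type*} [Group G] [Finite G]

theorem le_of_forall_commute_mem_of_isSolvable (hab : Commute a b) (ha : orderOf a = p)
    (hb : orderOf b = p) (hnot : a ∉ zpowers b) (f : E →* G) {T F : Subgroup G} [T.Normal]
    [hT : Group.IsSolvable T] (hpT : (Nat.card T).Coprime p)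
    (hF : ∀ e : E, orderOf e = p → ∀ t ∈ T, Commute (f e) t → t ∈ F) : T ≤ F := by
  induction T using solvable_normal_induction with
  | bot => exact bot_le
  | step T _ ih =>
    have hle : ⁅T, T⁆ ≤ T := commutator_le_self T
    have : Group.IsSolvable ↥⁅T, T⁆ :=
      Group.isSolvable_of_isSolvable_injective (inclusion_injective hle)
    have hcard : Nat.card ↥⁅T, T⁆ ∣ Nat.card T := card_dvd_of_le hle
    have hTF : ⁅T, T⁆ ≤ F :=
      ih (hpT.coprime_dvd_left hcard) fun e he t ht => hF e he t (hle ht)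
    let π := QuotientGroup.mk' ⁅T, T⁆
    let V := T.map π
    have := isMulCommutative_map_mk'_commutator_self T
    have : V.Normal := Normal.map inferInstance π (QuotientGroup.mk'_surjective _)
    let _ : CommGroup V := { mul_comm := mul_comm' }
    let _ : MulDistribMulAction E V :=
      MulDistribMulAction.compHom V ((MulAut.conjNormal (H := V)).comp (π.comp f))
    have hfix (e : E) (he : orderOf e = p) (v : V) (hv : e • v = v) :
        v ∈ (F.map π).subgroupOf V := by
      obtain ⟨_, t, ht, rfl⟩ := v
      have hcop : (Nat.card ↥⁅T, T⁆).Coprime (orderOf (f e)) :=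
        (hpT.coprime_dvd_left hcard).coprime_dvd_right (he ▸ orderOf_map_dvd f e)
      obtain ⟨k, hk, hcomm⟩ := exists_mul_commute_of_coprime_orderOf hcop (h := t)
        (mul_inv_eq_iff_eq_mul.1 (congrArg Subtype.val hv))
      have htk : t * k ∈ F := hF e he _ (mul_mem ht (hle hk)) hcomm
      exact ⟨t * k, htk, by simp [π, (QuotientGroup.eq_one_iff k).2 hk]⟩
    intro x hx
    have hxV : π x ^ p ∈ F.map π :=
      pow_mem_of_forall_smul_eq_mem hab ha hb hnot hfix ⟨π x, x, hx, rfl⟩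
    have hxF : x ^ p ∈ F := by
      rw [← comap_map_eq_self ((QuotientGroup.ker_mk' ⁅T, T⁆).trans_le hTF), mem_comap, map_pow]
      exact hxV
    have hcop : p.Coprime (orderOf x) :=
      (hpT.coprime_dvd_left (T.orderOf_dvd_natCard hx)).symm
    exact (zpowers_le.2 hxF) (mem_zpowers_pow_iff.2 hcop)

end RankTwo

theorem exists_sylow_le_normalizer_map {G : Type*} [Group G] [Finite G] {p : ℕ} [hp : Fact p.Prime]
    {Q : Subgroup G} (hQ : IsPGroup p Q) {M : Subgroup G} [M.Normal] (hpM : (Nat.card M).Coprime p)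
    (q : ℕ) [Fact q.Prime] :
    ∃ S : Sylow q M, Q ≤ normalizer ((S : Subgroup M).map M.subtype : Set G) := by
  let _ : MulDistribMulAction Q M :=
    MulDistribMulAction.compHom M ((MulAut.conjNormal (H := M)).comp Q.subtype)
  have hcard : ¬ p ∣ Nat.card (Sylow q M) := fun h => by
    rw [Sylow.card_eq_index_normalizer default] at h
    exact hp.out.coprime_iff_not_dvd.1 hpM.symm (h.trans (index_dvd_card _))
  obtain ⟨S, hS⟩ := hQ.nonempty_fixed_point_of_prime_not_dvd_card (Sylow q M) hcard
  refine ⟨S, fun x hx => mem_normalizer_iff_map_conj_eq.2 ?_⟩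
  have hx : (S : Subgroup M).map (MulAut.conjNormal x).toMonoidHom = S :=
    congrArg Sylow.toSubgroup (hS ⟨x, hx⟩)
  calc (S.map M.subtype).map (MulAut.conj x).toMonoidHom
      = ((S : Subgroup M).map (MulAut.conjNormal x).toMonoidHom).map M.subtype := by
        rw [map_map, map_map]; rfl
    _ = S.map M.subtype := by rw [hx]

theorem le_of_forall_exists_sylow_map_le {G : Type*} [Group G] [Finite G] {M F : Subgroup G}
    (h : ∀ q : ℕ, q.Prime → ∃ S : Sylow q M, S.map M.subtype ≤ F) : M ≤ F := by
  rw [← relIndex_eq_one]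
  by_contra hne
  obtain ⟨q, hq, hdvd⟩ := Nat.exists_prime_and_dvd hne
  have : Fact q.Prime := ⟨hq⟩
  obtain ⟨S, hS⟩ := h q hq
  exact S.not_dvd_index (hdvd.trans (index_dvd_of_le (map_le_iff_le_comap.1 hS)))

theorem le_of_forall_commute_mem {E : Type*} [Group E] {p : ℕ} [hp : Fact p.Prime]
    (hE : IsPGroup p E) {a b : E} (hab : Commute a b) (ha : orderOf a = p)
    (hb : orderOf b = p) (hnot : a ∉ zpowers b) {G : Type*} [Group G] [Finite G] (f : E →* G)
    {M F : Subgroup G} [M.Normal] (hpM : (Nat.card M).Coprime p)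
    (hF : ∀ e : E, orderOf e = p → ∀ t ∈ M, Commute (f e) t → t ∈ F) : M ≤ F := by
  refine le_of_forall_exists_sylow_map_le fun q hq => ?_
  have : Fact q.Prime := ⟨hq⟩
  obtain ⟨S, hS⟩ := exists_sylow_le_normalizer_map (hE.of_surjective f.rangeRestrict
    f.rangeRestrict_surjective) hpM q
  refine ⟨S, ?_⟩
  set T : Subgroup G := S.map M.subtype
  let N := normalizer (T : Set G)
  let f' : E →* N := f.codRestrict N fun e => hS ⟨e, rfl⟩
  have : Group.IsSolvable (T.subgroupOf N) := by
    have : Group.IsNilpotent T := (S.isPGroup'.map M.subtype).isNilpotent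
    exact Group.isSolvable_of_isSolvable_injective
      (f := (subgroupOfEquivOfLe (le_normalizer : T ≤ N)).toMonoidHom) (MulEquiv.injective _)
  have hT : T.subgroupOf N ≤ F.subgroupOf N := by
    refine le_of_forall_commute_mem_of_isSolvable hab ha hb hnot f' ?_ fun e he t ht hcomm => ?_
    · rw [Nat.card_congr (subgroupOfEquivOfLe (le_normalizer : T ≤ N)).toEquiv]
      exact hpM.coprime_dvd_left (card_dvd_of_le (map_subtype_le _))
    · exact hF e he t (map_subtype_le _ ht) (hcomm.map N.subtype)
  exact fun x hx => hT (show ⟨x, le_normalizer hx⟩ ∈ T.subgroupOf N from hx)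

section ZGroupComplement

theorem normal_of_le_of_isCyclic {G : Type*} [Group G] {A B : Subgroup G} [B.Normal] [IsCyclic B]
    (hAB : A ≤ B) : A.Normal := by
  refine ⟨fun a ha g => ?_⟩
  obtain ⟨m, hm⟩ := MonoidHom.map_cyclic ((MulAut.conjNormal g : MulAut B) : B →* B)
  have hconj : g * a * g⁻¹ = a ^ m := by simpa using congrArg Subtype.val (hm ⟨a, hAB ha⟩)
  exact hconj ▸ zpow_mem ha m

theorem card_ker_inf_mul_card_map {G N : Type*} [Group G] [Group N] (f : G →* N)
    (K : Subgroup G) : Nat.card (f.ker ⊓ K : Subgroup G) * Nat.card (K.map f) = Nat.card K := by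
  rw [← relIndex_ker, ← inf_relIndex_right, ← relIndex_bot_left,
    relIndex_mul_relIndex _ _ _ bot_le inf_le_right, relIndex_bot_left]

theorem isCyclic_commutator_self {G : Type*} [Group G] [Finite G] (H : Subgroup G) [IsZGroup H] :
    IsCyclic ↥⁅H, H⁆ := by
  have := IsZGroup.isCyclic_commutator H
  rw [← map_subtype_commutator]
  exact isCyclic_of_surjective _ (H.subtype.subgroupMap_surjective (_root_.commutator H))

theorem coprime_card_commutator_relIndex {G : Type*} [Group G] [Finite G] (H : Subgroup G)
    [IsZGroup H] : (Nat.card ↥⁅H, H⁆).Coprime (relIndex ⁅H, H⁆ H) := by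
  rw [← map_subtype_commutator, card_map_of_injective H.subtype_injective, relIndex, subgroupOf,
    comap_map_eq_self_of_injective H.subtype_injective]
  exact IsZGroup.coprime_commutator_index H

variable {G : Type*} [Group G] [Finite G] {p : ℕ} [Fact p.Prime]

theorem le_centralizer_of_isCyclic_of_coprime {P Q : Subgroup G} [P.Normal] [IsCyclic P]
    (hP : IsPGroup p P) (hcop : (Nat.card P).Coprime (Nat.card Q))
    (hne : P ⊓ centralizer (Q : Set G) ≠ ⊥) : Q ≤ centralizer (P : Set G) := by
  let _ : CommGroup P := IsCyclic.commGroup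
  let _ : MulDistribMulAction Q P :=
    MulDistribMulAction.compHom P ((MulAut.conjNormal (H := P)).comp Q.subtype)
  obtain htriv | hsurj := hP.smul_mul_inv_trivial_or_surjective hcop
  · refine fun k hk => mem_centralizer_iff.2 fun g hg => ?_
    exact (mul_inv_eq_iff_eq_mul.1 (mul_inv_eq_one.1
      (congrArg Subtype.val (htriv ⟨g, hg⟩ ⟨k, hk⟩)))).symm
  · obtain ⟨x, ⟨hxP, hxQ⟩, hx1⟩ := (bot_or_exists_ne_one _).resolve_left hne
    obtain ⟨g, hg⟩ := IsCyclic.exists_generator (α := P)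
    obtain ⟨k, y, hky⟩ := hsurj g
    let φ : P →* P := MulDistribMulAction.toMonoidHom P k / MonoidHom.id P
    have hφ : Function.Surjective φ := by
      rw [← MonoidHom.range_eq_top, eq_top_iff]
      refine fun z _ => (zpowers_le.2 ?_) (hg z)
      exact ⟨y, (div_eq_mul_inv _ _).trans hky⟩
    have hφx : φ ⟨x, hxP⟩ = 1 := by
      refine div_eq_one.2 (Subtype.ext (mul_inv_eq_iff_eq_mul.2 ?_))
      exact mem_centralizer_iff.1 hxQ k k.2
    have := (injective_iff_map_eq_one φ).1 (Finite.injective_iff_surjective.2 hφ) _ hφx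
    exact absurd (congrArg Subtype.val this) hx1

theorem not_dvd_card_normalClosure_of_le_centralizer {P Q : Subgroup G} [P.Normal]
    [IsMulCommutative P] (hP : IsPGroup p P) (hindex : ¬ p ∣ P.index) (hpQ : ¬ p ∣ Nat.card Q)
    (hQP : Q ≤ centralizer (P : Set G)) : ¬ p ∣ Nat.card (normalClosure (Q : Set G)) := by
  set C := centralizer (P : Set G)
  have hPC : P ≤ C := le_centralizer_iff_isMulCommutative.2 inferInstance
  let S : Sylow p C := IsPGroup.toSylow (P := P.subgroupOf C) (hP.comap_subtype)
    fun h => hindex (h.trans (relIndex_dvd_index_of_le hPC))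
  have hS : normalizer (S : Set C) ≤ centralizer (S : Set C) := fun c _ =>
    mem_centralizer_iff.2 fun x hx => Subtype.ext (mem_centralizer_iff.1 c.2 x hx)
  have hker (c : C) (hc : ¬ p ∣ orderOf c) : c ∈ (MonoidHom.transferSylow S hS).ker := by
    by_contra hc1
    exact hc ((S.2.dvd_orderOf hc1).trans (orderOf_map_dvd _ c))
  have hle : normalClosure (Q : Set G) ≤ (MonoidHom.transferSylow S hS).ker.map C.subtype := by
    refine (closure_le _).2 fun y hy => ?_
    obtain ⟨q, hq, hqy⟩ := Group.mem_conjugatesOfSet_iff.1 hy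
    obtain ⟨g, rfl⟩ := isConj_iff.1 hqy
    refine ⟨⟨g * q * g⁻¹, Normal.conj_mem inferInstance q (hQP hq) g⟩, hker _ fun hdvd => hpQ ?_,
      rfl⟩
    have hord : orderOf (g * q * g⁻¹) = orderOf q :=
      orderOf_injective (MulAut.conj g).toMonoidHom (MulAut.conj g).injective q
    rw [orderOf_mk, hord] at hdvd
    exact hdvd.trans (Q.orderOf_dvd_natCard hq)
  refine fun h => MonoidHom.not_dvd_card_ker_transferSylow S hS ?_
  rw [← card_map_of_injective C.subtype_injective]
  exact h.trans (card_dvd_of_le hle)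

theorem not_dvd_card_normalClosure_of_isCyclic {A Q : Subgroup G} [A.Normal] [IsCyclic A]
    (hindex : ¬ p ∣ A.index) (hpQ : ¬ p ∣ Nat.card Q)
    (hAQ : p ∣ Nat.card (A ⊓ centralizer (Q : Set G) : Subgroup G)) :
    ¬ p ∣ Nat.card (normalClosure (Q : Set G)) := by
  obtain ⟨⟨x, hxAQ⟩, hx⟩ := exists_prime_orderOf_dvd_card' p hAQ
  rw [orderOf_mk] at hx
  obtain ⟨hxA, hxQ⟩ := hxAQ
  have hxp : IsPGroup p (zpowers (⟨x, hxA⟩ : A)) :=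
    IsPGroup.of_card (n := 1) (by rw [Nat.card_zpowers, orderOf_mk, pow_one, hx])
  obtain ⟨S, hxS⟩ := hxp.exists_le_sylow
  set P : Subgroup G := (S : Subgroup A).map A.subtype with hPdef
  have hPA : P ≤ A := map_subtype_le _
  have hP : IsPGroup p P := S.2.map _
  have : P.Normal := normal_of_le_of_isCyclic hPA
  have : IsCyclic P := isCyclic_of_le hPA
  have hPindex : ¬ p ∣ P.index := by
    rw [hPdef, index_map_subtype]
    exact Nat.Prime.not_dvd_mul Fact.out S.not_dvd_index hindex
  have hcop : (Nat.card P).Coprime (Nat.card Q) := by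
    obtain ⟨n, hn⟩ := IsPGroup.iff_card.1 hP
    exact hn ▸ Nat.Coprime.pow_left n ((Nat.Prime.coprime_iff_not_dvd Fact.out).2 hpQ)
  have hne : P ⊓ centralizer (Q : Set G) ≠ ⊥ := fun h => by
    have hx1 : x ∈ P ⊓ centralizer (Q : Set G) := ⟨⟨_, hxS (mem_zpowers _), rfl⟩, hxQ⟩
    rw [h, mem_bot, ← orderOf_eq_one_iff, hx] at hx1
    exact Nat.Prime.ne_one Fact.out hx1
  exact not_dvd_card_normalClosure_of_le_centralizer hP hPindex hpQ
    (le_centralizer_of_isCyclic_of_coprime hP hcop hne)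

open scoped IsMulCommutative in
theorem not_dvd_card_normalClosure_of_isZGroup {H Q : Subgroup G} [H.Normal] [IsZGroup H]
    (hindex : ¬ p ∣ H.index) (hpQ : ¬ p ∣ Nat.card Q)
    (hHQ : p ∣ Nat.card (H ⊓ centralizer (Q : Set G) : Subgroup G)) :
    ¬ p ∣ Nat.card (normalClosure (Q : Set G)) := by
  have hp : p.Prime := Fact.out
  let π := QuotientGroup.mk' ⁅H, H⁆
  have hπ : Function.Surjective π := QuotientGroup.mk'_surjective _
  have hker : π.ker = ⁅H, H⁆ := QuotientGroup.ker_mk' _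
  have : (H.map π).Normal := Normal.map inferInstance π hπ
  rw [← card_ker_inf_mul_card_map π, hker] at hHQ
  obtain hdvd | hdvd := hp.dvd_mul.1 hHQ
  · have hrel : ¬ p ∣ relIndex ⁅H, H⁆ H := fun h => Nat.not_coprime_of_dvd_of_dvd hp.one_lt
      (hdvd.trans (card_dvd_of_le inf_le_left)) h (coprime_card_commutator_relIndex H)
    have := isCyclic_commutator_self H
    refine not_dvd_card_normalClosure_of_isCyclic (A := ⁅H, H⁆) ?_ hpQ ?_
    · rw [← relIndex_mul_index (commutator_le_self H)]
      exact hp.not_dvd_mul hrel hindex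
    · exact hdvd.trans (card_dvd_of_le (inf_le_inf_left _ inf_le_right))
  · have hmap : p ∣ Nat.card (H.map π ⊓ centralizer (Q.map π : Set (G ⧸ ⁅H, H⁆)) : Subgroup _) :=
      hdvd.trans (card_dvd_of_le ((map_inf_le _ _ _).trans
        (inf_le_inf_left _ (map_centralizer_le_centralizer_image _ _))))
    have hH' : ¬ p ∣ Nat.card ↥⁅H, H⁆ := fun h => by
      have hrel : p ∣ relIndex ⁅H, H⁆ H := by
        rw [← hker, relIndex_ker]
        exact hmap.trans (card_dvd_of_le inf_le_left)
      exact Nat.not_coprime_of_dvd_of_dvd hp.one_lt h hrel (coprime_card_commutator_relIndex H)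
    have : IsZGroup (H.map π) := .of_surjective (π.subgroupMap_surjective H)
    have := isMulCommutative_map_mk'_commutator_self H
    have : IsCyclic (H.map π) := inferInstance
    rw [← card_ker_inf_mul_card_map π, hker]
    refine hp.not_dvd_mul (fun h => hH' (h.trans (card_dvd_of_le inf_le_left))) ?_
    rw [map_normalClosure _ _ hπ]
    exact not_dvd_card_normalClosure_of_isCyclic (Q := Q.map π)
      (fun h => hindex (h.trans (index_map_dvd _ hπ)))
      (fun h => hpQ (h.trans (card_map_dvd _ π))) hmap

theorem coprime_card_inf_centralizer_normalClosure {H Q : Subgroup G} [H.Normal] [IsZGroup H]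
    (hcop : (Nat.card H).Coprime (Nat.card Q)) (hsup : H ⊔ Q = ⊤) :
    (Nat.card (H ⊓ centralizer (Q : Set G) : Subgroup G)).Coprime
      (Nat.card (normalClosure (Q : Set G))) := by
  refine Nat.coprime_of_dvd fun p hp hpC => ?_
  have : Fact p.Prime := ⟨hp⟩
  have hpQ : ¬ p ∣ Nat.card Q := fun h =>
    Nat.not_coprime_of_dvd_of_dvd hp.one_lt (hpC.trans (card_dvd_of_le inf_le_left)) h hcop
  have hindex : H.index ∣ Nat.card Q := by
    rw [← relIndex_top_right, ← hsup, relIndex_sup_left]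
    exact relIndex_dvd_card _ _
  exact not_dvd_card_normalClosure_of_isZGroup (fun h => hpQ (h.trans hindex)) hpQ hpC

theorem inf_centralizer_sup_normalClosure_eq_top {H Q : Subgroup G} [H.Normal]
    [Group.IsSolvable H] (hcop : (Nat.card H).Coprime (Nat.card Q)) (hsup : H ⊔ Q = ⊤) :
    H ⊓ centralizer (Q : Set G) ⊔ normalClosure (Q : Set G) = ⊤ := by
  set L := normalClosure (Q : Set G)
  have hQL : Q ≤ L := subset_normalClosure
  have : Group.IsSolvable ↥(H ⊓ L) :=
    Group.isSolvable_of_isSolvable_injective (inclusion_injective inf_le_left)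
  refine eq_top_iff.2 (hsup.ge.trans (sup_le (fun h hh => ?_) (hQL.trans le_sup_right)))
  have hcomm (q : G) (hq : q ∈ Q) : h⁻¹ * (q * h * q⁻¹) ∈ H ⊓ L := by
    refine ⟨H.mul_mem (H.inv_mem hh) (Normal.conj_mem inferInstance h hh q), ?_⟩
    rw [← mul_assoc, ← mul_assoc]
    simpa using mul_mem (Normal.conj_mem inferInstance q (hQL hq) h⁻¹) (inv_mem (hQL hq))
  obtain ⟨k, hk, hkQ⟩ := exists_mul_commute_of_coprime
    (hcop.coprime_dvd_left (card_dvd_of_le inf_le_left)) hcomm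
  rw [← mul_inv_cancel_right h k]
  exact mul_mem (mem_sup_left ⟨mul_mem hh hk.1, mem_centralizer_iff.2 hkQ⟩)
    (mem_sup_right (L.inv_mem hk.2))

end ZGroupComplement

section HallSubgroups

theorem exists_sylow_le_of_not_dvd_index {G : Type*} [Group G] [Finite G] {p : ℕ} [Fact p.Prime]
    {K : Subgroup G} (hK : ¬ p ∣ K.index) : ∃ P : Sylow p G, ↑P ≤ K := by
  obtain ⟨S⟩ : Nonempty (Sylow p K) := inferInstance
  refine ⟨(S.2.map K.subtype).toSylow ?_, map_subtype_le _⟩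
  rw [index_map_subtype]
  exact Nat.Prime.not_dvd_mul Fact.out S.not_dvd_index hK

theorem not_dvd_index_of_not_dvd_relIndex_normalizer {G : Type*} [Group G] [Finite G] {p : ℕ}
    [Fact p.Prime] {P : Subgroup G} (hP : IsPGroup p P)
    (h : ¬ p ∣ P.relIndex (normalizer (P : Set G))) : ¬ p ∣ P.index := fun hdvd => by
  obtain ⟨n, hn⟩ := IsPGroup.iff_card.1 hP
  refine h (Sylow.prime_dvd_card_quotient_normalizer (n := n) ?_ hn)
  rw [← P.card_mul_index, hn, pow_succ]
  exact mul_dvd_mul_left _ hdvd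

theorem relIndex_sup_eq_relIndex_of_normal_right {G : Type*} [Group G] [Finite G]
    (K R : Subgroup G) [R.Normal] : K.relIndex (K ⊔ R) = K.relIndex R := by
  have hmul : K.relIndex R * R.relIndex (K ⊔ R) = R.relIndex K * K.relIndex (K ⊔ R) := by
    rw [← inf_relIndex_right K R, ← inf_relIndex_left K R,
      relIndex_mul_relIndex _ _ _ inf_le_right le_sup_right,
      relIndex_mul_relIndex _ _ _ inf_le_left le_sup_left]
  rw [relIndex_sup_right, mul_comm] at hmul
  exact (Nat.eq_of_mul_eq_mul_left (Nat.pos_of_ne_zero index_ne_zero_of_finite) hmul).symm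

theorem relIndex_dvd_index_of_normal_right {G : Type*} [Group G] [Finite G] (K R : Subgroup G)
    [R.Normal] : K.relIndex R ∣ K.index :=
  relIndex_sup_eq_relIndex_of_normal_right K R ▸ relIndex_dvd_index_of_le le_sup_left

theorem IsPiNumber.of_dvd {π : Set ℕ} {m n : ℕ} (hn : IsPiNumber π n) (h : m ∣ n) :
    IsPiNumber π m :=
  fun p hp hpm => hn p hp (hpm.trans h)

theorem IsPiNumber.coprime_of_compl {m n : ℕ} (h : IsPiNumber {p : ℕ | p.Prime ∧ p ∣ m}ᶜ n) :
    m.Coprime n :=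
  Nat.coprime_of_dvd fun p hp hpm hpn => h p hp hpn ⟨hp, hpm⟩

theorem IsPiNumber.coprime_of_coprime {m n k : ℕ} (h : IsPiNumber {p : ℕ | p.Prime ∧ p ∣ m} n)
    (hmk : m.Coprime k) : n.Coprime k :=
  Nat.coprime_of_dvd fun p hp hpn hpk =>
    Nat.not_coprime_of_dvd_of_dvd hp.one_lt (h p hp hpn).2 hpk hmk

theorem IsPiSeparable.exists_normal_gt {G : Type*} [Group G] {π : Set ℕ} (h : IsPiSeparable π G)
    {M : Subgroup G} [M.Normal] (hM : M ≠ ⊤) : ∃ R : Subgroup G, R.Normal ∧ M < R ∧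
      (IsPiNumber π (M.relIndex R) ∨ IsPiNumber πᶜ (M.relIndex R)) := by
  obtain ⟨n, s, hs0, hsn, hnormal, hstep⟩ := h
  obtain ⟨j, hj, hjM, hj1M⟩ : ∃ j < n, s j ≤ M ∧ ¬ s (j + 1) ≤ M := by
    by_contra! hall
    have hle (i : ℕ) (hi : i ≤ n) : s i ≤ M := by
      induction i with
      | zero => exact hs0 ▸ bot_le
      | succ i ih => exact hall i hi (ih (Nat.le_of_succ_le hi))
    exact hM (top_le_iff.1 (hsn ▸ hle n le_rfl))
  have hrel : M.relIndex (s (j + 1) ⊔ M) ∣ (s j).relIndex (s (j + 1)) := by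
    rw [relIndex_sup_right]
    exact relIndex_dvd_of_le_left _ hjM
  have := hnormal (j + 1) hj
  exact ⟨s (j + 1) ⊔ M, inferInstance, right_lt_sup.2 hj1M,
    (hstep j hj).2.imp (·.of_dvd hrel) (·.of_dvd hrel)⟩

end HallSubgroups

section TI

variable {G : Type*} [Group G] [Finite G] {H : Subgroup G}

theorem Subgroup.IsTI.mem_normalizer (hTI : H.IsTI) {x h : G} (hh : h ∈ H) (h1 : h ≠ 1)
    (hx : x⁻¹ * h * x ∈ H) : x ∈ normalizer (H : Set G) := by
  have hmem : h ∈ H ⊓ H.map (MulAut.conj x).toMonoidHom :=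
    ⟨hh, x⁻¹ * h * x, hx, by simp [mul_assoc]⟩
  obtain hinf | hinf := hTI x
  · refine mem_normalizer_iff_map_conj_eq.2 (eq_of_le_of_card_ge (inf_eq_left.1 hinf) ?_).symm
    exact (card_map_of_injective (MulAut.conj x).injective).le
  · rw [hinf, mem_bot] at hmem
    exact absurd hmem h1

theorem Subgroup.IsTI.normalizer_le (hTI : H.IsTI) {P : Subgroup G} (hP : P ≠ ⊥) (hPH : P ≤ H) :
    normalizer (P : Set G) ≤ normalizer (H : Set G) := fun x hx => by
  obtain ⟨e, he, he1⟩ := (bot_or_exists_ne_one P).resolve_left hP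
  refine hTI.mem_normalizer (hPH he) he1 (hPH ?_)
  simpa using (mem_normalizer_iff.1 (inv_mem hx) e).1 he

theorem Subgroup.IsTI.isHall (hTI : H.IsTI)
    (hHall : (H.subgroupOf (normalizer (H : Set G))).IsHall) : H.IsHall := by
  refine Nat.coprime_of_dvd fun p hp hpH hpi => ?_
  have : Fact p.Prime := ⟨hp⟩
  obtain ⟨S⟩ : Nonempty (Sylow p H) := inferInstance
  set P : Subgroup G := (S : Subgroup H).map H.subtype with hPdef
  have hPH : P ≤ H := map_subtype_le _
  have hPbot : P ≠ ⊥ := (map_eq_bot_iff_of_injective _ H.subtype_injective).not.2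
    (S.ne_bot_of_dvd_card hpH)
  have hPrel : ¬ p ∣ P.relIndex H := by
    rw [relIndex, hPdef, subgroupOf, comap_map_eq_self_of_injective H.subtype_injective]
    exact S.not_dvd_index
  have hHrel : ¬ p ∣ H.relIndex (normalizer (H : Set G)) := fun h => by
    rw [IsHall, Nat.card_congr (subgroupOfEquivOfLe le_normalizer).toEquiv] at hHall
    exact Nat.not_coprime_of_dvd_of_dvd hp.one_lt hpH h hHall
  refine not_dvd_index_of_not_dvd_relIndex_normalizer (S.2.map H.subtype) (fun h => ?_)
    (hpi.trans (index_dvd_of_le hPH))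
  refine hp.not_dvd_mul hPrel hHrel ?_
  rw [relIndex_mul_relIndex _ _ _ hPH le_normalizer,
    ← relIndex_mul_relIndex _ _ _ le_normalizer (hTI.normalizer_le hPbot hPH)]
  exact h.mul_right _

theorem Subgroup.IsTI.normalizer_sup_eq_top (hTI : H.IsTI) (hH : H.IsHall) {M R : Subgroup G}
    [R.Normal] (hMR : M < R)
    (hR : IsPiNumber {p : ℕ | p.Prime ∧ p ∣ Nat.card H} (M.relIndex R)) :
    normalizer (H : Set G) ⊔ M = ⊤ := by
  have hRle : R ≤ H ⊔ M := relIndex_eq_one.1 <|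
    Nat.eq_one_of_dvd_coprimes (hR.coprime_of_coprime hH) (relIndex_dvd_of_le_left R le_sup_right)
      ((relIndex_dvd_index_of_normal_right _ R).trans (index_dvd_of_le le_sup_left))
  obtain ⟨p, hp, hpR⟩ := Nat.exists_prime_and_dvd (mt relIndex_eq_one.1 hMR.not_ge)
  have : Fact p.Prime := ⟨hp⟩
  obtain ⟨S, hSH⟩ := exists_sylow_le_of_not_dvd_index (p := p) (K := H.subgroupOf R) fun h =>
    Nat.not_coprime_of_dvd_of_dvd hp.one_lt (hR p hp hpR).2
      (h.trans (relIndex_dvd_index_of_normal_right H R)) hH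
  have hSbot : (S : Subgroup R).map R.subtype ≠ ⊥ :=
    (map_eq_bot_iff_of_injective _ R.subtype_injective).not.2
      (S.ne_bot_of_dvd_card (hpR.trans (relIndex_dvd_card _ _)))
  rw [eq_top_iff, ← Sylow.normalizer_sup_eq_top S]
  exact sup_le ((hTI.normalizer_le hSbot (map_le_iff_le_comap.2 hSH)).trans le_sup_left)
    (hRle.trans (sup_le_sup_right le_normalizer M))

theorem Subgroup.IsTI.exists_normal_coprime_normalizer_sup_eq_top (hTI : H.IsTI) (hH : H.IsHall)
    (hsep : IsPiSeparable {p : ℕ | p.Prime ∧ p ∣ Nat.card H} G) :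
    ∃ M : Subgroup G, M.Normal ∧ (Nat.card H).Coprime (Nat.card M) ∧
      normalizer (H : Set G) ⊔ M = ⊤ := by
  obtain ⟨M, ⟨hMn, hHM⟩, hmax⟩ := Set.Finite.exists_maximal
    (s := {M : Subgroup G | M.Normal ∧ (Nat.card H).Coprime (Nat.card M)}) (Set.toFinite _)
    ⟨⊥, inferInstance, by simp⟩
  refine ⟨M, hMn, hHM, ?_⟩
  by_cases hM : M = ⊤
  · rw [hM, sup_top_eq]
  obtain ⟨R, hRn, hMR, hR | hR⟩ := hsep.exists_normal_gt hM
  · exact hTI.normalizer_sup_eq_top hH hMR hR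
  · refine absurd (hmax ⟨hRn, ?_⟩ hMR.le) hMR.not_ge
    have hcard : Nat.card M * M.relIndex R = Nat.card R := by
      rw [← relIndex_bot_left, relIndex_mul_relIndex _ _ _ bot_le hMR.le, relIndex_bot_left]
    exact hcard ▸ hHM.mul_right hR.coprime_of_compl

theorem commute_of_commutatorElement_mem {G : Type*} [Group G] {H M : Subgroup G}
    (hHM : Disjoint H M) {q r : G} (hq : q ∈ normalizer (H : Set G)) (hr : r ∈ H)
    (h : ⁅q, r⁆ ∈ M) : Commute q r :=
  commutatorElement_eq_one_iff_commute.1 <| hHM.le_bot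
    ⟨H.mul_mem ((mem_normalizer_iff.1 hq r).1 hr) (H.inv_mem hr), h⟩

theorem Subgroup.IsTI.mem_centralizer (hTI : H.IsTI) {M : Subgroup G} [M.Normal]
    (hHM : (Nat.card H).Coprime (Nat.card M)) {h m : G} (hh : h ∈ H) (h1 : h ≠ 1) (hm : m ∈ M)
    (hcomm : Commute h m) : m ∈ centralizer (H : Set G) := by
  have hN : m ∈ normalizer (H : Set G) := by
    refine hTI.mem_normalizer hh h1 ?_
    rwa [mul_assoc, hcomm.eq, inv_mul_cancel_left]
  refine mem_centralizer_iff.2 fun k hk => ?_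
  refine (commute_of_commutatorElement_mem (disjoint_of_coprime_natCard hHM) hN hk ?_).symm
  rw [commutatorElement_def, mul_assoc, mul_assoc, ← mul_assoc k]
  exact M.mul_mem hm (Normal.conj_mem inferInstance _ (M.inv_mem hm) k)

theorem Subgroup.IsTI.isZGroup (hTI : H.IsTI) (hnn : ¬ H.Normal) {M : Subgroup G} [M.Normal]
    (hHM : (Nat.card H).Coprime (Nat.card M)) (hsup : normalizer (H : Set G) ⊔ M = ⊤)
    (P : Sylow 2 H) (hP : IsMulCommutative P) : IsZGroup H := by
  have hMH : ¬ M ≤ centralizer (H : Set G) := fun h => hnn <| by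
    rw [← normalizer_eq_top_iff, ← hsup, eq_comm, sup_eq_left]
    exact h.trans (centralizer_le_normalizer _)
  refine (isZGroup_iff H).2 fun p hp S => ?_
  have : Fact p.Prime := ⟨hp⟩
  refine isCyclic_of_forall_mem_zpowers_of_isPGroup S.2 ?_ fun a b ha hb hab => ?_
  · rintro rfl
    have e := S.equiv P
    exact isMulCommutative_iff.2 fun x y =>
      e.injective (by rw [map_mul, map_mul]; exact mul_comm' _ _)
  by_contra hnot
  let f : S →* G := H.subtype.comp (S : Subgroup H).subtype
  have hf : Function.Injective f :=
    H.subtype_injective.comp (S : Subgroup H).subtype_injective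
  have hfH (s : S) : f s ∈ H := SetLike.coe_mem (s : H)
  have hpH : p ∣ Nat.card H := by
    rw [← ha, ← orderOf_injective f hf]
    exact H.orderOf_dvd_natCard (hfH a)
  refine hMH (le_of_forall_commute_mem S.2 hab ha hb hnot f (hHM.coprime_dvd_left hpH).symm
    fun e he t ht => hTI.mem_centralizer hHM (hfH e) ?_ ht)
  rw [Ne, map_eq_one_iff f hf, ← orderOf_eq_one_iff, he]
  exact hp.ne_one

end TI

section Complement

variable {G : Type*} [Group G]

theorem map_inf_centralizer_eq {N : Type*} [Group N] (f : G →* N) {H Q : Subgroup G}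
    (hH : Disjoint H f.ker) (hQ : Q ≤ normalizer (H : Set G)) :
    (H ⊓ centralizer (Q : Set G)).map f = H.map f ⊓ centralizer (Q.map f : Set N) := by
  refine le_antisymm ((map_inf_le _ _ _).trans
    (inf_le_inf_left _ (map_centralizer_le_centralizer_image _ _))) ?_
  rintro _ ⟨⟨r, hr, rfl⟩, hrQ⟩
  refine ⟨r, ⟨hr, mem_centralizer_iff.2 fun q hq => ?_⟩, rfl⟩
  refine commute_of_commutatorElement_mem hH (hQ hq) hr ?_
  rw [MonoidHom.mem_ker, map_commutatorElement, commutatorElement_eq_one_iff_commute]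
  exact mem_centralizer_iff.1 hrQ (f q) ⟨q, hq, rfl⟩

theorem sup_eq_normalizer_of_isComplement' {H Q : Subgroup G}
    (hQ : Q ≤ normalizer (H : Set G))
    (hcompl : (H.subgroupOf (normalizer (H : Set G))).IsComplement'
      (Q.subgroupOf (normalizer (H : Set G)))) : H ⊔ Q = normalizer (H : Set G) := by
  have h := congrArg (Subgroup.map (normalizer (H : Set G)).subtype) hcompl.sup_eq_top
  rwa [Subgroup.map_sup, map_subgroupOf_eq_of_le le_normalizer, map_subgroupOf_eq_of_le hQ,
    ← MonoidHom.range_eq_map, range_subtype] at h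

theorem coprime_card_of_isComplement'_of_isHall {H Q : Subgroup G}
    (hHall : (H.subgroupOf (normalizer (H : Set G))).IsHall)
    (hQ : Q ≤ normalizer (H : Set G))
    (hcompl : (H.subgroupOf (normalizer (H : Set G))).IsComplement'
      (Q.subgroupOf (normalizer (H : Set G)))) : (Nat.card H).Coprime (Nat.card Q) := by
  rwa [IsHall, hcompl.symm.index_eq_card, Nat.card_congr (subgroupOfEquivOfLe hQ).toEquiv,
    Nat.card_congr (subgroupOfEquivOfLe le_normalizer).toEquiv] at hHall

theorem isHall_and_isComplement'_of_coprime {R L : Subgroup G} [L.Normal]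
    (hcop : (Nat.card R).Coprime (Nat.card L)) (hsup : R ⊔ L = ⊤) :
    R.IsHall ∧ L.IsComplement' R := by
  have hcompl : L.IsComplement' R := by
    refine isComplement'_of_disjoint_and_mul_eq_univ (disjoint_of_coprime_natCard hcop).symm ?_
    rw [← normal_mul, sup_comm, hsup, coe_top]
  refine ⟨?_, hcompl⟩
  rwa [IsHall, hcompl.index_eq_card]

theorem coprime_card_comap {N : Type*} [Group N] {f : G →* N} (hf : Function.Surjective f)
    {R : Subgroup G} {L : Subgroup N} (hker : (Nat.card R).Coprime (Nat.card f.ker))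
    (hRL : (Nat.card (R.map f)).Coprime (Nat.card L)) :
    (Nat.card R).Coprime (Nat.card (L.comap f)) := by
  have hcardR : Nat.card (R.map f) = Nat.card R := by
    rw [← card_ker_inf_mul_card_map f R, (disjoint_of_coprime_natCard hker).symm.eq_bot, card_bot,
      one_mul]
  rw [← card_ker_inf_mul_card_map f (L.comap f), map_comap_eq_self_of_surjective hf]
  exact (hker.coprime_dvd_right (card_dvd_of_le inf_le_left)).mul_right (hcardR ▸ hRL)

theorem sup_comap_eq_top {N : Type*} [Group N] {f : G →* N} (hf : Function.Surjective f)
    {R : Subgroup G} {L : Subgroup N} (hsup : R.map f ⊔ L = ⊤) : R ⊔ L.comap f = ⊤ := by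
  rw [← comap_map_eq_self ((ker_le_comap f L).trans le_sup_right), Subgroup.map_sup,
    map_comap_eq_self_of_surjective hf, hsup, comap_top]

theorem isHall_and_exists_isComplement'_of_isZGroup [Finite G] {H Q M : Subgroup G} [M.Normal]
    [IsZGroup H] (hHM : (Nat.card H).Coprime (Nat.card M))
    (hHQ : (Nat.card H).Coprime (Nat.card Q)) (hQ : Q ≤ normalizer (H : Set G))
    (hsup : H ⊔ Q ⊔ M = ⊤) :
    (H ⊓ centralizer (Q : Set G)).IsHall ∧
      ∃ N : Subgroup G, N.Normal ∧ N.IsComplement' (H ⊓ centralizer (Q : Set G)) := by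
  let π := QuotientGroup.mk' M
  have hπ : Function.Surjective π := QuotientGroup.mk'_surjective M
  have hker : π.ker = M := QuotientGroup.ker_mk' M
  have hmap : H.map π ⊔ Q.map π = ⊤ := by
    rw [← Subgroup.map_sup, ← MonoidHom.range_eq_top_of_surjective π hπ, map_eq_range_iff, hker]
    exact codisjoint_iff.2 hsup
  have : (H.map π).Normal := by
    rw [← normalizer_eq_top_iff, eq_top_iff, ← hmap]
    exact sup_le le_normalizer ((map_mono hQ).trans (le_normalizer_map π))
  have : IsZGroup (H.map π) := .of_surjective (π.subgroupMap_surjective H)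
  have hcop : (Nat.card (H.map π)).Coprime (Nat.card (Q.map π)) :=
    (hHQ.coprime_dvd_left (card_map_dvd _ π)).coprime_dvd_right (card_map_dvd _ π)
  have hR := map_inf_centralizer_eq π (hker.symm ▸ disjoint_of_coprime_natCard hHM) hQ
  have hRM : (Nat.card ↥(H ⊓ centralizer (Q : Set G))).Coprime (Nat.card π.ker) :=
    hker.symm ▸ hHM.coprime_dvd_left (card_dvd_of_le inf_le_left)
  let N := (normalClosure (Q.map π : Set (G ⧸ M))).comap π
  obtain ⟨hHall, hcompl⟩ := isHall_and_isComplement'_of_coprime (L := N)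
    (coprime_card_comap hπ hRM (hR ▸ coprime_card_inf_centralizer_normalClosure hcop hmap))
    (sup_comap_eq_top hπ (hR ▸ inf_centralizer_sup_normalClosure_eq_top hcop hmap))
  exact ⟨hHall, N, inferInstance, hcompl⟩

end Complement

theorem theorem1p4 {G : Type*} [Group G] [Finite G] (H Q : Subgroup G)
    (hTI : H.IsTI) (hnn : ¬ H.Normal)
    (hsep : IsPiSeparable {p : ℕ | p.Prime ∧ p ∣ Nat.card H} G)
    (hHall : (H.subgroupOf (Subgroup.normalizer (H : Set G))).IsHall)
    (P : Sylow 2 H) (hP : IsMulCommutative P)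
    (hQ : Q ≤ Subgroup.normalizer (H : Set G))
    (hcompl : (H.subgroupOf (Subgroup.normalizer (H : Set G))).IsComplement'
      (Q.subgroupOf (Subgroup.normalizer (H : Set G)))) :
    (H ⊓ Subgroup.centralizer (Q : Set G)).IsHall ∧
      ∃ N : Subgroup G, N.Normal ∧
        N.IsComplement' (H ⊓ Subgroup.centralizer (Q : Set G)) := by
  obtain ⟨M, _, hHM, hNM⟩ :=
    hTI.exists_normal_coprime_normalizer_sup_eq_top (hTI.isHall hHall) hsep
  have : IsZGroup H := hTI.isZGroup hnn hHM hNM P hP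
  have hHQ : H ⊔ Q = normalizer (H : Set G) := sup_eq_normalizer_of_isComplement' hQ hcompl
  exact isHall_and_exists_isComplement'_of_isZGroup hHM
    (coprime_card_of_isComplement'_of_isHall hHall hQ hcompl) hQ (hHQ.symm ▸ hNM)
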